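/- Let $A,B,C$ be complex $n\times n$ matrices with $A+B+C=0$, and let $\alpha(1)\ge\dots\ge\alpha(n)$, $\beta(1)\ge\dots\ge\beta(n)$ and $\gamma(1)\ge\dots\ge\gamma(n)$ be the singular values of $A$, $B$ and $C$, respectively, in non-ascending order and repeated according to multiplicity. Let $0\le m\le n$, let $1\le i_1<i_2<\dots<i_m\le n$ be integers, put $I=\{i_1,\dots,i_m\}$, and let $b$ be an integer with $1\le b\le m+1$. Put $$I_L=\{i_b,\dots,i_m\},\qquad I_R=\{i_1,\dots,i_{m-b+1}\},\qquad J=\{b,\dots,m\}$$ (all three sets are empty if $b=m+1$). For a finite set $K$ of indices write $\alpha(K)=\sum_{k\in K}\alpha(k)$, and similarly $\beta(K)$ and $\gamma(K)$. Then for every partition $I=I_C\cup I_A$ of $I$ into two disjoint, possibly empty, sets, $$\gamma(I_C\cap I_L)+\alpha(I_A\cap I_L)\ \le\ \alpha(I_C\cap I_R)+\gamma(I_A\cap I_R)+\beta(J).$$ -/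

import Mathlib

/-- `singVal A k` is the `k`-th singular value, counted from `k = 1` in non-ascending order and
with multiplicity, of the square complex matrix `A`, seen as an operator on Euclidean space.
(Mathlib counts the singular values of a linear map from `0`.) -/
noncomputable def singVal {n : ℕ} (A : Matrix (Fin n) (Fin n) ℂ) (k : ℕ) : ℝ :=
  (Matrix.toEuclideanLin A).singularValues (k - 1)

open scoped InnerProductSpace

/-! ### Diagonal Hermitian forms and Weyl's inequality -/

section SpectralForms

variable {E : Type*} [NormedAddCommGroup E] [InnerProductSpace ℂ E] {N : ℕ}

/-! The Hermitian dilation `2 Re ⟪x, A y⟫` has eigenvalues `±α(k)`, and those of `A`, `B` add up to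
that of `-C`. Put `s = b - 1`, `r = m - s` and pair `i j` with `i (j + s)` for `1 ≤ j ≤ r`. A pair
inside `I_C` asks to bound `γ(i (j + s))` by `α(i j)`; a pair inside `I_A` asks the same of the
negative eigenvalues `-γ(i j)`, `-α(i (j + s))`. A mixed pair compares two singular values of one
matrix, so monotonicity suffices.

The unmixed pairs are treated at once by `sum_eigenvalues_add_le`. There the second form is replaced
by a nonnegative one of rank at most `r` plus a constant `c`, at the cost of `s` linear conditions.
Adding the nonnegative form raises every eigenvalue, by its trace in total; Weyl's inequality with
shift `s` does the rest. -/

/-- The Hermitian form that is diagonal in the orthonormal basis `e`, with eigenvalues `a`. -/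
noncomputable def diagForm (e : OrthonormalBasis (Fin N) ℂ E) (a : ℕ → ℝ) (x : E) : ℝ :=
  ∑ i : Fin N, a i * ‖⟪e i, x⟫_ℂ‖ ^ 2

theorem norm_sq_eq_sum_inner (e : OrthonormalBasis (Fin N) ℂ E) (x : E) :
    ‖x‖ ^ 2 = ∑ i, ‖⟪e i, x⟫_ℂ‖ ^ 2 := (e.sum_sq_norm_inner_right x).symm

/-- Weyl's inequality: a comparison of two forms on a subspace of codimension at most `s` compares
their eigenvalues up to a shift of the index by `s`. -/
theorem eigenvalue_le_of_diagForm_le (e f : OrthonormalBasis (Fin N) ℂ E) (a g : ℕ → ℝ)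
    (ha : Antitone fun i : Fin N ↦ a i) (hg : Antitone fun i : Fin N ↦ g i)
    (w : ℕ → E) (s : ℕ) (c : ℝ)
    (h : ∀ x, (∀ k < s, ⟪w k, x⟫_ℂ = 0) → diagForm f g x ≤ diagForm e a x + c * ‖x‖ ^ 2)
    (p q : Fin N) (hpq : (p : ℕ) + s ≤ q) : g q ≤ a p + c := by
  have : FiniteDimensional ℂ E := e.toBasis.finiteDimensional_of_finite
  -- A nonzero `x` in the kernel exists since `(N - 1 - q) + p + s < N`.
  let φ : E →ₗ[ℂ] (({i : Fin N // q < i} ⊕ {i : Fin N // i < p}) ⊕ Fin s → ℂ) :=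
    LinearMap.pi (Sum.elim (Sum.elim (fun i ↦ (innerₛₗ ℂ (f i)))
      (fun i ↦ innerₛₗ ℂ (e i))) (fun k ↦ innerₛₗ ℂ (w k)))
  have hker : LinearMap.ker φ ≠ ⊥ := by
    apply LinearMap.ker_ne_bot_of_finrank_lt
    rw [Module.finrank_fintype_fun_eq_card, Module.finrank_eq_card_basis e.toBasis]
    have h1 : Fintype.card {i : Fin N // q < i} = N - 1 - q := by
      rw [Fintype.card_subtype, ← Fin.card_Ioi]
      congr 1; ext; simp
    have h2 : Fintype.card {i : Fin N // i < p} = p := by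
      rw [Fintype.card_subtype, ← Fin.card_Iio]
      congr 1; ext; simp
    simp only [Fintype.card_sum, h1, h2, Fintype.card_fin]
    have := q.2
    omega
  obtain ⟨x, hx, hx0⟩ := (Submodule.ne_bot_iff _).1 hker
  have hx' : ∀ j, φ x j = 0 := fun j ↦ by rw [LinearMap.mem_ker.1 hx]; rfl
  have hf : ∀ i, q < i → ⟪f i, x⟫_ℂ = 0 := fun i hi ↦ hx' (.inl (.inl ⟨i, hi⟩))
  have he : ∀ i, i < p → ⟪e i, x⟫_ℂ = 0 := fun i hi ↦ hx' (.inl (.inr ⟨i, hi⟩))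
  have hw : ∀ k < s, ⟪w k, x⟫_ℂ = 0 := fun k hk ↦ hx' (.inr ⟨k, hk⟩)
  have hlow : g q * ‖x‖ ^ 2 ≤ diagForm f g x := by
    rw [norm_sq_eq_sum_inner f, Finset.mul_sum, diagForm]
    refine Finset.sum_le_sum fun i _ ↦ ?_
    rcases lt_or_ge q i with hi | hi
    · simp [hf i hi]
    · exact mul_le_mul_of_nonneg_right (hg hi) (by positivity)
  have hupp : diagForm e a x ≤ a p * ‖x‖ ^ 2 := by
    rw [norm_sq_eq_sum_inner e, Finset.mul_sum, diagForm]
    refine Finset.sum_le_sum fun i _ ↦ ?_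
    rcases lt_or_ge i p with hi | hi
    · simp [he i hi]
    · exact mul_le_mul_of_nonneg_right (ha hi) (by positivity)
  have hpos : 0 < ‖x‖ ^ 2 := by positivity
  nlinarith [h x hw]

/-- The operator that is diagonal in the orthonormal basis `e`, with eigenvalues `a`. -/
noncomputable def diagOp (e : OrthonormalBasis (Fin N) ℂ E) (a : ℕ → ℝ) : E →ₗ[ℂ] E :=
  ∑ i : Fin N, (a i : ℂ) • (InnerProductSpace.rankOne ℂ (e i) (e i) : E →ₗ[ℂ] E)

theorem inner_diagOp (e : OrthonormalBasis (Fin N) ℂ E) (a : ℕ → ℝ) (x y : E) :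
    ⟪x, diagOp e a y⟫_ℂ = ∑ i : Fin N, (a i : ℂ) * (⟪x, e i⟫_ℂ * ⟪e i, y⟫_ℂ) := by
  simp [diagOp, mul_comm]

theorem diagOp_isSymmetric (e : OrthonormalBasis (Fin N) ℂ E) (a : ℕ → ℝ) :
    (diagOp e a).IsSymmetric := by
  intro x y
  rw [← inner_conj_symm, inner_diagOp, inner_diagOp, map_sum]
  refine Finset.sum_congr rfl fun i _ ↦ ?_
  simp [mul_comm]

theorem re_inner_diagOp (e : OrthonormalBasis (Fin N) ℂ E) (a : ℕ → ℝ) (x : E) :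
    (⟪x, diagOp e a x⟫_ℂ).re = diagForm e a x := by
  rw [inner_diagOp, diagForm, Complex.re_sum]
  refine Finset.sum_congr rfl fun i _ ↦ ?_
  rw [← inner_conj_symm, ← Complex.normSq_eq_conj_mul_self, Complex.normSq_eq_norm_sq]
  norm_cast

theorem trace_diagOp (e : OrthonormalBasis (Fin N) ℂ E) (a : ℕ → ℝ) :
    (diagOp e a).trace ℂ E = ((∑ i : Fin N, a i : ℝ) : ℂ) := by
  have : FiniteDimensional ℂ E := e.toBasis.finiteDimensional_of_finite
  simp [diagOp, InnerProductSpace.trace_rankOne]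

end SpectralForms

/-! ### Eigenvalue sums for a sum of two forms -/

section LidskiiType

variable {E : Type*} [NormedAddCommGroup E] [InnerProductSpace ℂ E] {N : ℕ}

/-- The sum of two diagonal forms is diagonal in some orthonormal basis, and the traces add. -/
theorem exists_diagForm_eq_add (e w : OrthonormalBasis (Fin N) ℂ E) (a t : ℕ → ℝ) :
    ∃ (f : OrthonormalBasis (Fin N) ℂ E) (μ : ℕ → ℝ), (Antitone fun i : Fin N ↦ μ i) ∧
      (∀ x, diagForm f μ x = diagForm e a x + diagForm w t x) ∧
      ∑ i : Fin N, μ i = ∑ i : Fin N, a i + ∑ i : Fin N, t i := by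
  have : FiniteDimensional ℂ E := e.toBasis.finiteDimensional_of_finite
  have hN : Module.finrank ℂ E = N := by
    rw [Module.finrank_eq_card_basis e.toBasis, Fintype.card_fin]
  have hT : (diagOp e a + diagOp w t).IsSymmetric :=
    (diagOp_isSymmetric e a).add (diagOp_isSymmetric w t)
  set f := hT.eigenvectorBasis hN
  set μ : ℕ → ℝ := fun i ↦ if h : i < N then hT.eigenvalues hN ⟨i, h⟩ else 0 with hμ
  have hμi (i : Fin N) : μ i = hT.eigenvalues hN i := by simp [hμ]
  refine ⟨f, μ, ?_, fun x ↦ ?_, ?_⟩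
  · simpa only [hμi] using hT.eigenvalues_antitone hN
  · rw [← re_inner_diagOp e, ← re_inner_diagOp w, ← Complex.add_re, ← inner_add_right,
      ← LinearMap.add_apply, ← f.sum_inner_mul_inner, diagForm, Complex.re_sum]
    refine Finset.sum_congr rfl fun i _ ↦ ?_
    have h := hT.eigenvectorBasis_apply_self_apply hN x i
    rw [OrthonormalBasis.repr_apply_apply, OrthonormalBasis.repr_apply_apply] at h
    rw [h, ← inner_conj_symm x (f i), mul_left_comm, ← Complex.normSq_eq_conj_mul_self,
      Complex.normSq_eq_norm_sq, hμi]
    exact (Complex.re_ofReal_mul (hT.eigenvalues hN i) ((‖⟪f i, x⟫_ℂ‖ ^ 2 : ℝ) : ℂ)).symm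
  · have h := hT.re_trace_eq_sum_eigenvalues hN
    rw [map_add, trace_diagOp, trace_diagOp, ← Complex.ofReal_add] at h
    simp only [hμi]
    exact h.symm

/-- A Thompson–Freede type inequality for the eigenvalues of a sum of Hermitian forms, when the
second form contributes a block of consecutive eigenvalues. -/
theorem sum_eigenvalues_add_le {ι : Type*} (e f w : OrthonormalBasis (Fin N) ℂ E)
    (a g β : ℕ → ℝ) (ha : Antitone fun i : Fin N ↦ a i) (hg : Antitone fun i : Fin N ↦ g i)
    (hβ : Antitone fun i : Fin N ↦ β i)
    (hform : ∀ x, diagForm f g x = diagForm e a x + diagForm w β x)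
    (s r : ℕ) (hr : 0 < r) (hsr : s + r ≤ N) (hpos : 0 ≤ β (s + r - 1))
    (K : Finset ι) (p q : ι → Fin N) (hp : Set.InjOn p K) (hK : K.card ≤ r)
    (hpq : ∀ j ∈ K, (p j : ℕ) + s ≤ q j) :
    ∑ j ∈ K, g (q j) ≤ ∑ j ∈ K, a (p j) + ∑ k ∈ Finset.Ico s (s + r), β k := by
  -- `c` is the least eigenvalue of the block, so `t`, the excess over `c` on the block, is
  -- nonnegative.
  set c := β (s + r - 1) with hc
  have hβ' : ∀ {k l : ℕ}, k ≤ l → l < N → β l ≤ β k := fun {k l} hkl hl ↦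
    hβ (show (⟨k, hkl.trans_lt hl⟩ : Fin N) ≤ ⟨l, hl⟩ from hkl)
  set t : ℕ → ℝ := fun k ↦ if k ∈ Finset.Ico s (s + r) then β k - c else 0 with ht
  have ht0 : ∀ k, 0 ≤ t k := fun k ↦ by
    simp only [ht, Finset.mem_Ico]
    split_ifs with hk
    · exact sub_nonneg.2 (hβ' (by omega) (by omega))
    · exact le_rfl
  obtain ⟨m, μ, hμ, hm, htr⟩ := exists_diagForm_eq_add e w a t
  have hmono : ∀ i : Fin N, a i ≤ μ i := fun i ↦ by
    simpa using eigenvalue_le_of_diagForm_le m e μ a hμ ha (fun _ ↦ 0) 0 0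
      (fun x _ ↦ by
        rw [hm, zero_mul, add_zero, le_add_iff_nonneg_right]
        exact Finset.sum_nonneg fun i _ ↦ mul_nonneg (ht0 i) (by positivity)) i i le_rfl
  -- Orthogonally to the first `s` vectors of `w`, the form of `β` is at most that of `t` plus `c *
  -- ‖x‖ ^ 2`.
  have hshift : ∀ j ∈ K, g (q j) ≤ μ (p j) + c := fun j hj ↦ by
    refine eigenvalue_le_of_diagForm_le m f μ g hμ hg
      (fun k ↦ if hk : k < N then w ⟨k, hk⟩ else 0) s c (fun x hx ↦ ?_) _ _ (hpq j hj)
    rw [hform, hm, add_assoc, norm_sq_eq_sum_inner w, Finset.mul_sum, diagForm.eq_def w,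
      diagForm.eq_def w, ← Finset.sum_add_distrib]
    gcongr with i
    by_cases his : (i : ℕ) < s
    · have := hx i his
      simp only [i.2, dite_true, Fin.eta] at this
      simp [this]
    · rw [← add_mul]
      refine mul_le_mul_of_nonneg_right ?_ (by positivity)
      simp only [ht, Finset.mem_Ico]
      split_ifs with hi
      · linarith
      · rw [zero_add]
        exact hβ' (by omega) i.2
  have hsum : ∑ j ∈ K, (μ (p j) - a (p j)) ≤ ∑ k ∈ Finset.Ico s (s + r), (β k - c) := by
    calc ∑ j ∈ K, (μ (p j) - a (p j))
        = ∑ i ∈ K.image p, (μ i - a i) := by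
          rw [Finset.sum_image hp]
      _ ≤ ∑ i : Fin N, (μ i - a i) :=
          Finset.sum_le_sum_of_subset_of_nonneg (Finset.subset_univ _)
            fun i _ _ ↦ sub_nonneg.2 (hmono i)
      _ = ∑ i : Fin N, t i := by rw [Finset.sum_sub_distrib, htr]; ring
      _ = ∑ k ∈ Finset.range N, t k := Fin.sum_univ_eq_sum_range t N
      _ = ∑ k ∈ Finset.Ico s (s + r), (β k - c) := by
          rw [ht, ← Finset.sum_filter]
          congr 1
          ext k
          simp only [Finset.mem_filter, Finset.mem_range, Finset.mem_Ico]
          omega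
  have hgs := Finset.sum_le_sum hshift
  -- `K` may have fewer than `r` elements; this is where `0 ≤ c` is needed.
  have hKc : (K.card : ℝ) * c ≤ r * c :=
    mul_le_mul_of_nonneg_right (by exact_mod_cast hK) hpos
  simp only [Finset.sum_add_distrib, Finset.sum_sub_distrib, Finset.sum_const, nsmul_eq_mul,
    Nat.card_Ico, add_tsub_cancel_left] at hgs hsum
  linarith

end LidskiiType

/-! ### Singular values and the Hermitian dilation -/

section Dilation

variable {V : Type*} [NormedAddCommGroup V] [InnerProductSpace ℂ V] {n : ℕ}

/-- The singular value decomposition. -/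
theorem exists_singularValue_decomposition [FiniteDimensional ℂ V]
    (hn : Module.finrank ℂ V = n) (A : V →ₗ[ℂ] V) :
    ∃ e f : OrthonormalBasis (Fin n) ℂ V, ∀ k, A (e k) = (A.singularValues k : ℂ) • f k := by
  set hS := A.isSymmetric_adjoint_comp_self
  set e := hS.eigenvectorBasis hn
  have hinner (j k : Fin n) : ⟪A (e j), A (e k)⟫_ℂ =
      (A.singularValues k : ℂ) ^ 2 * (if j = k then 1 else 0) := by
    rw [← LinearMap.adjoint_inner_right, ← LinearMap.comp_apply, hS.apply_eigenvectorBasis hn k,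
      inner_smul_right, ← A.sq_singularValues_fin hn k,
      orthonormal_iff_ite.1 e.orthonormal j k]
    norm_cast
  -- Normalised images under `A`, meaningful only where the singular value is nonzero; the remaining
  -- vectors of `f` are arbitrary.
  let v : Fin n → V := fun k ↦ ((A.singularValues k : ℂ)⁻¹) • A (e k)
  have hv : Orthonormal ℂ (({k : Fin n | A.singularValues k ≠ 0} : Set (Fin n)).domRestrict v) := by
    rw [orthonormal_iff_ite]
    rintro ⟨j, hj⟩ ⟨k, hk⟩
    have hk' : (A.singularValues k : ℂ) ≠ 0 := by exact_mod_cast hk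
    simp only [Set.domRestrict_apply, v, inner_smul_left, inner_smul_right, hinner,
      Subtype.mk.injEq]
    split_ifs with h
    · subst h
      rw [map_inv₀, Complex.conj_ofReal]
      field_simp
    · simp
  obtain ⟨f, hf⟩ := hv.exists_orthonormalBasis_extension_of_card_eq (by rw [hn, Fintype.card_fin])
  refine ⟨e, f, fun k ↦ ?_⟩
  by_cases hk : A.singularValues k = 0
  · have := hinner k k
    simp only [hk, Complex.ofReal_zero, zero_pow two_ne_zero, zero_mul, inner_self_eq_zero] at this
    simp [hk, this]
  · have hk' : (A.singularValues k : ℂ) ≠ 0 := by exact_mod_cast hk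
    rw [hf k hk, smul_smul, mul_inv_cancel₀ hk', one_smul]

/-- When `A e k = σ k • f k` is a singular value decomposition, these are the eigenvectors of `(x,
y) ↦ (A y, A* x)`, for `σ k` and `-σ k`. -/
theorem orthonormal_dilation (e f : OrthonormalBasis (Fin n) ℂ V) :
    Orthonormal ℂ (fun i : Fin n ⊕ Fin n ↦ (((√2 : ℝ) : ℂ)⁻¹) •
      Sum.elim (fun k ↦ WithLp.toLp 2 (f k, e k)) (fun k ↦ WithLp.toLp 2 (f k, -e k)) i) := by
  have h2 : ((√2 : ℝ) : ℂ)⁻¹ * (((√2 : ℝ) : ℂ)⁻¹ * 2) = 1 := by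
    have h : ((√2 : ℝ) : ℂ) ^ 2 = 2 := by
      rw [← Complex.ofReal_pow, Real.sq_sqrt (by norm_num)]; norm_num
    have h0 : ((√2 : ℝ) : ℂ) ≠ 0 := by
      rw [Complex.ofReal_ne_zero]; positivity
    field_simp
    rw [h]
  have he := orthonormal_iff_ite.1 e.orthonormal
  have hf := orthonormal_iff_ite.1 f.orthonormal
  rw [orthonormal_iff_ite]
  rintro (j | j) (k | k) <;>
    simp only [inner_smul_left, inner_smul_right, map_inv₀, Complex.conj_ofReal, Sum.elim_inl,
      Sum.elim_inr, WithLp.prod_inner_apply, inner_neg_left, inner_neg_right, he, hf,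
      Sum.inl.injEq, Sum.inr.injEq, reduceCtorEq, if_false] <;>
    split_ifs <;> first | (norm_num; done) | (norm_num; exact h2)

/-- The eigenvalues of the Hermitian dilation of an operator with singular values `σ`. -/
noncomputable def dilationEigenvalue (n : ℕ) (σ : ℕ → ℝ) (i : ℕ) : ℝ :=
  if i < n then σ i else -σ (n + n - 1 - i)

theorem dilationEigenvalue_antitone {σ : ℕ → ℝ} (hσ : Antitone σ) (h0 : ∀ k, 0 ≤ σ k) :
    Antitone fun i : Fin (n + n) ↦ dilationEigenvalue n σ i := by
  intro i j hij
  have hij' : (i : ℕ) ≤ j := hij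
  simp only [dilationEigenvalue]
  split_ifs with h1 h2
  · exact hσ hij
  · omega
  · linarith [h0 i, h0 (n + n - 1 - j)]
  · exact neg_le_neg (hσ (by omega))

/-- The Hermitian dilation of `A`, as a quadratic form, is diagonal in an orthonormal basis, with
eigenvalues plus and minus the singular values of `A`. -/
theorem exists_diagForm_dilation [FiniteDimensional ℂ V]
    (hn : Module.finrank ℂ V = n) (A : V →ₗ[ℂ] V) :
    ∃ w : OrthonormalBasis (Fin (n + n)) ℂ (WithLp 2 (V × V)), ∀ x,
      diagForm w (dilationEigenvalue n A.singularValues) x =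
        2 * (⟪x.fst, A x.snd⟫_ℂ).re := by
  obtain ⟨e, f, hef⟩ := exists_singularValue_decomposition hn A
  have hv := orthonormal_dilation e f
  obtain ⟨b, hb⟩ := Orthonormal.exists_orthonormalBasis_extension_of_card_eq
    (𝕜 := ℂ) (s := Set.univ) (v := fun i : Fin n ⊕ Fin n ↦ (((√2 : ℝ) : ℂ)⁻¹) •
      Sum.elim (fun k ↦ WithLp.toLp 2 (f k, e k)) (fun k ↦ WithLp.toLp 2 (f k, -e k)) i)
    (by rw [(WithLp.linearEquiv 2 ℂ (V × V)).finrank_eq, Module.finrank_prod, hn]; simp)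
    (hv.comp _ Subtype.val_injective)
  -- Reversing the second copy puts the negative eigenvalues in non-ascending order.
  let φ : Fin n ⊕ Fin n ≃ Fin (n + n) :=
    (Equiv.sumCongr (Equiv.refl _) Fin.revPerm).trans finSumFinEquiv
  refine ⟨b.reindex φ, fun x ↦ ?_⟩
  rw [diagForm, ← φ.sum_comp, Fintype.sum_sum_type, ← Finset.sum_add_distrib,
    ← e.sum_repr x.snd, map_sum, inner_sum, Complex.re_sum, Finset.mul_sum]
  refine Finset.sum_congr rfl fun k _ ↦ ?_
  have h1 : (φ (.inl k) : ℕ) = k := by simp [φ]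
  have h2 : (φ (.inr k) : ℕ) = n + (n - 1 - k) := by simp [φ, Fin.val_rev]; omega
  have h3 : n + n - 1 - (n + (n - 1 - k)) = k := by omega
  have hsq : ‖((√2 : ℝ) : ℂ)⁻¹‖ ^ 2 = 1 / 2 := by
    rw [norm_inv, Complex.norm_real, inv_pow, Real.norm_eq_abs, sq_abs,
      Real.sq_sqrt (by norm_num)]
    norm_num
  rw [OrthonormalBasis.reindex_apply, OrthonormalBasis.reindex_apply, Equiv.symm_apply_apply,
    Equiv.symm_apply_apply, hb _ trivial, hb _ trivial, h1, h2, dilationEigenvalue,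
    dilationEigenvalue, if_pos k.2, if_neg (by omega), h3]
  simp only [inner_smul_left, Sum.elim_inl, Sum.elim_inr, WithLp.prod_inner_apply, inner_neg_left,
    norm_mul, mul_pow, RCLike.norm_conj, hsq, map_smul, hef, inner_smul_right,
    OrthonormalBasis.repr_apply_apply]
  rw [← inner_conj_symm x.fst (f k)]
  change A.singularValues k * (1 / 2 * ‖⟪f k, x.fst⟫_ℂ + ⟪e k, x.snd⟫_ℂ‖ ^ 2) +
    -A.singularValues k * (1 / 2 * ‖⟪f k, x.fst⟫_ℂ + -⟪e k, x.snd⟫_ℂ‖ ^ 2)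
    = 2 * (⟪e k, x.snd⟫_ℂ * (_ * (starRingEnd ℂ) ⟪f k, x.fst⟫_ℂ)).re
  -- What remains is polarization, `‖u + v‖² - ‖u - v‖² = 4 Re (v ū)`.
  generalize ⟪f k, x.fst⟫_ℂ = u
  generalize ⟪e k, x.snd⟫_ℂ = v
  rw [← Complex.normSq_eq_norm_sq, ← Complex.normSq_eq_norm_sq]
  simp only [Complex.normSq_apply, Complex.add_re, Complex.add_im, Complex.neg_re, Complex.neg_im,
    Complex.mul_re, Complex.mul_im, Complex.conj_re, Complex.conj_im, Complex.ofReal_re,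
    Complex.ofReal_im]
  ring

end Dilation
-- Transfer to matrices
section MatrixSums

theorem LinearMap.singularValues_neg {V W : Type*} [NormedAddCommGroup V] [InnerProductSpace ℂ V]
    [FiniteDimensional ℂ V] [NormedAddCommGroup W] [InnerProductSpace ℂ W]
    [FiniteDimensional ℂ W] (T : V →ₗ[ℂ] W) : (-T).singularValues = T.singularValues := by
  have h : LinearMap.adjoint (-T) ∘ₗ (-T) = LinearMap.adjoint T ∘ₗ T := by ext; simp
  unfold LinearMap.singularValues
  congr! 5

theorem singVal_nonneg {n : ℕ} (A : Matrix (Fin n) (Fin n) ℂ) (k : ℕ) : 0 ≤ singVal A k :=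
  LinearMap.singularValues_nonneg _ _

theorem singVal_antitone {n : ℕ} (A : Matrix (Fin n) (Fin n) ℂ) : Antitone (singVal A) :=
  fun _ _ h ↦ LinearMap.singularValues_antitone _ (by omega)

/-- The Thompson–Freede type inequality for the eigenvalues of Hermitian dilations of matrices. -/
theorem sum_dilationEigenvalue_le {n : ℕ} {ι : Type*} (A B C : Matrix (Fin n) (Fin n) ℂ)
    (hABC : A + B + C = 0) (s r : ℕ) (hr : 0 < r) (hsr : s + r ≤ n) (K : Finset ι)
    (p q : ι → ℕ) (hp : Set.InjOn p K) (hK : K.card ≤ r)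
    (hpq : ∀ j ∈ K, p j + s ≤ q j) (hq : ∀ j ∈ K, q j < n + n) :
    ∑ j ∈ K, dilationEigenvalue n (Matrix.toEuclideanLin C).singularValues (q j) ≤
      ∑ j ∈ K, dilationEigenvalue n (Matrix.toEuclideanLin A).singularValues (p j) +
        ∑ k ∈ Finset.Ico s (s + r), (Matrix.toEuclideanLin B).singularValues k := by
  have hn : Module.finrank ℂ (EuclideanSpace ℂ (Fin n)) = n := by simp
  obtain ⟨e, he⟩ := exists_diagForm_dilation hn (Matrix.toEuclideanLin A)
  obtain ⟨w, hw⟩ := exists_diagForm_dilation hn (Matrix.toEuclideanLin B)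
  obtain ⟨f, hf⟩ := exists_diagForm_dilation hn (-Matrix.toEuclideanLin C)
  rw [LinearMap.singularValues_neg] at hf
  have hanti (M : Matrix (Fin n) (Fin n) ℂ) := dilationEigenvalue_antitone (n := n)
    (Matrix.toEuclideanLin M).singularValues_antitone
    (Matrix.toEuclideanLin M).singularValues_nonneg
  have hC : -Matrix.toEuclideanLin C = Matrix.toEuclideanLin A + Matrix.toEuclideanLin B := by
    rw [← map_neg, ← map_add, ← eq_neg_of_add_eq_zero_left hABC]
  have hB : ∀ k < n, dilationEigenvalue n (Matrix.toEuclideanLin B).singularValues k =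
      (Matrix.toEuclideanLin B).singularValues k := fun k hk ↦ by
    rw [dilationEigenvalue, if_pos hk]
  -- Reduction mod `n + n` only makes the indices total functions into `Fin (n + n)`; on `K` it
  -- changes nothing.
  have hpK : ∀ j ∈ K, p j % (n + n) = p j := fun j hj ↦
    Nat.mod_eq_of_lt (by have := hpq j hj; have := hq j hj; omega)
  have hqK : ∀ j ∈ K, q j % (n + n) = q j := fun j hj ↦ Nat.mod_eq_of_lt (hq j hj)
  have key := sum_eigenvalues_add_le e f w _ _ _ (hanti A) (hanti C) (hanti B) (fun x ↦ by
    rw [he, hw, hf, hC, LinearMap.add_apply, inner_add_right, Complex.add_re, mul_add])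
    s r hr (by omega)
    (by rw [hB _ (by omega)]; exact LinearMap.singularValues_nonneg _ _) K
    (fun j ↦ ⟨p j % (n + n), Nat.mod_lt _ (by omega)⟩)
    (fun j ↦ ⟨q j % (n + n), Nat.mod_lt _ (by omega)⟩)
    (fun j hj k hk h ↦ hp hj hk (by
      have := Fin.mk.inj h
      rwa [hpK j hj, hpK k hk] at this)) hK
    (fun j hj ↦ by simpa only [hpK j hj, hqK j hj] using hpq j hj)
  rw [Finset.sum_congr rfl fun j hj ↦ congrArg _ (hqK j hj),
    Finset.sum_congr rfl fun j hj ↦ congrArg _ (hpK j hj)] at key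
  refine key.trans_eq (congrArg _ ?_)
  exact Finset.sum_congr rfl fun k hk ↦ hB k (by rw [Finset.mem_Ico] at hk; omega)

end MatrixSums

/-! ### Pairing the indices -/

theorem StrictMonoOn.add_le_apply_add {m : ℕ} {i : ℕ → ℕ} (hi : StrictMonoOn i (Set.Icc 1 m))
    {j s : ℕ} (hj : 1 ≤ j) (hjs : j + s ≤ m) : i j + s ≤ i (j + s) := by
  induction s with
  | zero => rfl
  | succ s ih =>
    have h1 := ih (by omega)
    have h2 : i (j + s) < i (j + s + 1) :=
      hi ⟨by omega, by omega⟩ ⟨by omega, by omega⟩ (by omega)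
    have h3 : j + (s + 1) = j + s + 1 := by omega
    rw [h3]
    omega

theorem Finset.sum_inter_image {ι κ : Type*} [DecidableEq κ] (P : Finset κ) (S : Finset ι)
    (i : ι → κ) (hi : Set.InjOn i S) (F : κ → ℝ) :
    ∑ k ∈ P ∩ S.image i, F k = ∑ j ∈ S, if i j ∈ P then F (i j) else 0 := by
  rw [Finset.inter_comm, ← Finset.filter_mem_eq_inter, Finset.sum_filter, Finset.sum_image hi]

theorem theorem3 (n : ℕ) (A B C : Matrix (Fin n) (Fin n) ℂ)
    (hABC : A + B + C = 0)
    -- the indices `1 ≤ i 1 < i 2 < ⋯ < i m ≤ n`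
    (m : ℕ) (hmn : m ≤ n) (i : ℕ → ℕ)
    (hmono : StrictMonoOn i (Set.Icc 1 m))
    (hrange : ∀ k ∈ Set.Icc 1 m, i k ∈ Set.Icc 1 n)
    (b : ℕ) (hb : 1 ≤ b) (hbm : b ≤ m + 1)
    (I_C I_A I_L I_R : Finset ℕ)
    -- `I_C` and `I_A` partition `I = {i 1, …, i m}` (one of them may be empty)
    (hunion : I_C ∪ I_A = (Finset.Icc 1 m).image i) (hdisj : Disjoint I_C I_A)
    (hL : I_L = (Finset.Icc b m).image i)
    (hR : I_R = (Finset.Icc 1 (m + 1 - b)).image i) :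
    ∑ k ∈ I_C ∩ I_L, singVal C k + ∑ k ∈ I_A ∩ I_L, singVal A k
      ≤ ∑ k ∈ I_C ∩ I_R, singVal A k + ∑ k ∈ I_A ∩ I_R, singVal C k
        + ∑ k ∈ Finset.Icc b m, singVal B k := by
  obtain ⟨s, rfl⟩ : ∃ s, b = s + 1 := ⟨b - 1, by omega⟩
  obtain ⟨r, rfl⟩ : ∃ r, m = s + r := ⟨m - s, by omega⟩
  obtain rfl | hr := r.eq_zero_or_pos
  · simp [hL, hR]
  have hr1 : s + r + 1 - (s + 1) = r := by omega
  rw [hr1] at hR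
  have hshift : Finset.Icc (s + 1) (s + r) = (Finset.Icc 1 r).image (· + s) := by
    rw [Finset.image_add_right_Icc, add_comm 1, add_comm r]
  have hL' : I_L = (Finset.Icc 1 r).image fun j ↦ i (j + s) := by
    rw [hL, hshift, Finset.image_image]; rfl
  have hinjL : Set.InjOn (fun j ↦ i (j + s)) (Finset.Icc 1 r) := by
    intro j hj k hk h
    rw [Finset.mem_coe, Finset.mem_Icc] at hj hk
    have := hmono.injOn (x₁ := j + s) (x₂ := k + s) ⟨by omega, by omega⟩
      ⟨by omega, by omega⟩ h
    omega
  have hinjR : Set.InjOn i (Finset.Icc 1 r) := by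
    intro j hj k hk h
    rw [Finset.mem_coe, Finset.mem_Icc] at hj hk
    exact hmono.injOn ⟨by omega, by omega⟩ ⟨by omega, by omega⟩ h
  have hrng : ∀ j, 1 ≤ j → j ≤ s + r → 1 ≤ i j ∧ i j ≤ n := fun j h1 h2 ↦ hrange j ⟨h1, h2⟩
  have hxor : ∀ j, 1 ≤ j → j ≤ s + r → (i j ∈ I_A ↔ i j ∉ I_C) := fun j h1 h2 ↦ by
    have hmem : i j ∈ I_C ∪ I_A := by
      rw [hunion]
      exact Finset.mem_image_of_mem i (Finset.mem_Icc.2 ⟨h1, h2⟩)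
    exact ⟨fun h h' ↦ Finset.disjoint_left.1 hdisj h' h,
      fun h ↦ (Finset.mem_union.1 hmem).resolve_left h⟩
  -- The unmixed pairs.
  set K := (Finset.Icc 1 r).filter fun j ↦ (i j ∈ I_C ↔ i (j + s) ∈ I_C) with hKdef
  have hmemK : ∀ {j}, j ∈ K → 1 ≤ j ∧ j ≤ r ∧ (i j ∈ I_C ↔ i (j + s) ∈ I_C) := fun {j} hj ↦ by
    rw [hKdef, Finset.mem_filter, Finset.mem_Icc] at hj
    tauto
  -- Zero-based positions: `k - 1` carries the `k`-th singular value and `n + n - k` its negative.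
  -- Negation reverses order, so a pair in `I_A` swaps roles.
  let p : ℕ → ℕ := fun j ↦ if i j ∈ I_C then i j - 1 else n + n - i (j + s)
  let q : ℕ → ℕ := fun j ↦ if i j ∈ I_C then i (j + s) - 1 else n + n - i j
  have hp : Set.InjOn p K := by
    intro j hj k hk h
    obtain ⟨hj1, hj2, hj3⟩ := hmemK hj
    obtain ⟨hk1, hk2, hk3⟩ := hmemK hk
    have bj := hrng j hj1 (by omega)
    have bk := hrng k hk1 (by omega)
    have bj' := hrng (j + s) (by omega) (by omega)
    have bk' := hrng (k + s) (by omega) (by omega)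
    have hR := hinjR (x₁ := j) (x₂ := k) (by simp [*]) (by simp [*])
    have hL := hinjL (x₁ := j) (x₂ := k) (by simp [*]) (by simp [*])
    simp only [p] at h hL
    -- In the two middle cases one position is below `n` and the other is not.
    split_ifs at h
    · exact hR (by omega)
    · omega
    · omega
    · exact hL (by omega)
  have key := sum_dilationEigenvalue_le A B C hABC s r hr hmn K p q hp
    ((Finset.card_filter_le _ _).trans (by simp))
    (fun j hj ↦ by
      obtain ⟨hj1, hj2, -⟩ := hmemK hj
      have := hmono.add_le_apply_add hj1 (show j + s ≤ s + r by omega)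
      have bj := hrng j hj1 (by omega)
      have bj' := hrng (j + s) (by omega) (by omega)
      simp only [p, q]
      split_ifs <;> omega)
    (fun j hj ↦ by
      obtain ⟨hj1, hj2, -⟩ := hmemK hj
      have bj := hrng j hj1 (by omega)
      have bj' := hrng (j + s) (by omega) (by omega)
      simp only [q]
      split_ifs <;> omega)
  have hJ : ∑ k ∈ Finset.Icc (s + 1) (s + r), singVal B k =
      ∑ k ∈ Finset.Ico s (s + r), (Matrix.toEuclideanLin B).singularValues k := by
    rw [show Finset.Icc (s + 1) (s + r) = (Finset.Ico s (s + r)).image (· + 1) by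
      rw [Finset.image_add_right_Ico]; rfl, Finset.sum_image (by simp)]
    rfl
  rw [hJ, hL', hR, Finset.sum_inter_image _ _ _ hinjL, Finset.sum_inter_image _ _ _ hinjL,
    Finset.sum_inter_image _ _ _ hinjR, Finset.sum_inter_image _ _ _ hinjR,
    ← Finset.sum_add_distrib, ← Finset.sum_add_distrib]
  rw [← sub_le_iff_le_add', ← Finset.sum_sub_distrib] at key ⊢
  refine le_trans ?_ key
  rw [hKdef, Finset.sum_filter]
  refine Finset.sum_le_sum fun j hj ↦ ?_
  rw [Finset.mem_Icc] at hj
  have bj := hrng j hj.1 (by omega)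
  have bj' := hrng (j + s) (by omega) (by omega)
  have hxj := hxor j hj.1 (by omega)
  have hxj' := hxor (j + s) (by omega) (by omega)
  have hle : i j ≤ i (j + s) :=
    (Nat.le_add_right _ _).trans (hmono.add_le_apply_add hj.1 (show j + s ≤ s + r by omega))
  have hA := singVal_antitone A hle
  have hC := singVal_antitone C hle
  have hsmall (M : Matrix (Fin n) (Fin n) ℂ) (k : ℕ) (h1 : 1 ≤ k) (h2 : k ≤ n) :
      dilationEigenvalue n (Matrix.toEuclideanLin M).singularValues (k - 1) = singVal M k := by
    rw [dilationEigenvalue, if_pos (by omega), singVal]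
  have hlarge (M : Matrix (Fin n) (Fin n) ℂ) (k : ℕ) (h1 : 1 ≤ k) (h2 : k ≤ n) :
      dilationEigenvalue n (Matrix.toEuclideanLin M).singularValues (n + n - k) =
        -singVal M k := by
    rw [dilationEigenvalue, if_neg (by omega), singVal]
    congr 2
    omega
  -- Unmixed pairs give equality; mixed ones use `hA` or `hC`.
  by_cases h1 : i j ∈ I_C <;> by_cases h2 : i (j + s) ∈ I_C <;>
    simp only [hxj, hxj', h1, h2, p, q, if_true, if_false, not_true_eq_false, not_false_eq_true,
      iff_true, iff_false, hsmall _ _ bj.1 bj.2, hsmall _ _ bj'.1 bj'.2, hlarge _ _ bj.1 bj.2,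
      hlarge _ _ bj'.1 bj'.2] <;>
    linarith
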